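/- Let $R$ be a two-sided noetherian ring, and let $M$ be a finitely generated right $R$-module. For a resolution $\cdots\to P_1\xrightarrow{\partial_1}P_0\xrightarrow{\partial_0}M\to0$ by finitely generated projective modules, put $\Omega^iM=\operatorname{Im}\partial_i$ (so $\Omega^0M=M$). For a finitely generated right module $X$ with a presentation $Q_1\xrightarrow{d}Q_0\to X\to0$ by finitely generated projective modules, the transpose is the left module $\operatorname{Tr}X=\operatorname{Cok}(d^*\colon Q_0^*\to Q_1^*)$, where $(-)^*=\operatorname{Hom}_R(-,R)$. Both are unique up to projective summands. For $m\ge0$ let $\mathsf{TF}_m(R)$ be the class of finitely generated right modules $X$ with $\operatorname{Ext}^l_{R^{\mathrm{op}}}(\operatorname{Tr}X,R)=0$ for all $1\le l\le m$. The grade of a left module $N$ is $\operatorname{grade}_{R^{\mathrm{op}}}N=\inf\{i\ge0 : \operatorname{Ext}^i_{R^{\mathrm{op}}}(N,R)\ne0\}\in\mathbb{N}\cup\{\infty\}$. Let $n\ge1$ and $j\ge1$ be integers, and suppose that $\operatorname{grade}_{R^{\mathrm{op}}}\operatorname{Ext}^i_R(M,R)\ge i+j-1$ for all $1\le i\le n$.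 Then, for all choices of the projective resolution of $M$ defining the modules $\Omega^iM$ and of the projective presentations defining the transposes $\operatorname{Tr}\Omega^iM$, the following hold. 1. For all $1\le k\le j-1$ and $1\le i\le n$ there is an isomorphism of right $R$-modules $$\operatorname{Ext}^{i+k}_{R^{\mathrm{op}}}(\operatorname{Tr}\Omega^iM,R)\cong\operatorname{Ext}^{i-1+k}_{R^{\mathrm{op}}}(\operatorname{Tr}\Omega^{i-1}M,R).$$ 2. For all $1\le i\le n$ there is a monomorphism of right $R$-modules $$\operatorname{Ext}^{i+j}_{R^{\mathrm{op}}}(\operatorname{Tr}\Omega^iM,R)\hookrightarrow\operatorname{Ext}^{i-1+j}_{R^{\mathrm{op}}}(\operatorname{Tr}\Omega^{i-1}M,R).$$ 3. For all $1\le i\le n$, if $\Omega^{i-1}M\in\mathsf{TF}_{i-1+j}(R)$, then $\Omega^iM\in\mathsf{TF}_{i+j}(R)$. Thus $M\in\mathsf{TF}_j(R)\Rightarrow\Omega M\in\mathsf{TF}_{j+1}(R)\Rightarrow\cdots\Rightarrow\Omega^nM\in\mathsf{TF}_{n+j}(R)$. 4. For all $0\le m\le j-1$ and $1\le i\le n$,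 $\Omega^{i-1}M\in\mathsf{TF}_{i-1+m}(R)$ if and only if $\Omega^iM\in\mathsf{TF}_{i+m}(R)$. Thus $M\in\mathsf{TF}_m(R)\Leftrightarrow\Omega M\in\mathsf{TF}_{m+1}(R)\Leftrightarrow\cdots\Leftrightarrow\Omega^nM\in\mathsf{TF}_{n+m}(R)$. 5. For all $0\le m\le j-1$ and $0\le i\le n$, if $\Omega^iM\in\mathsf{TF}_{i+m+1}(R)$, then $\Omega^iM\in\mathsf{TF}_{i+m}(R)$. -/

import Mathlib

open CategoryTheory CategoryTheory.Abelian

universe u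

namespace StableModule

noncomputable section

/-!
Throughout, `D` is an `A`-`B`-bimodule in the sense that the rings `A` and `B` act on it by
commuting (left) actions. For a ring `R`, right `R`-modules are modules over `Rᵐᵒᵖ`, and the
bimodule `R` is used with `(A, B) = (Rᵐᵒᵖ, R)` for right modules and with `(A, B) = (R, Rᵐᵒᵖ)`
for left modules. -/

/-- The group `Ext_A^i(M, D)`. -/
def ExtD (A : Type u) [Ring A] (D : Type u) [AddCommGroup D] [Module A D]
    (M : ModuleCat.{u} A) (i : ℕ) : Type u :=
  Ext.{u} M (ModuleCat.of A D) i

instance ExtD.instAddCommGroup (A : Type u) [Ring A] (D : Type u) [AddCommGroup D] [Module A D]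
    (M : ModuleCat.{u} A) (i : ℕ) : AddCommGroup (ExtD A D M i) :=
  inferInstanceAs (AddCommGroup (Ext.{u} M (ModuleCat.of A D) i))

/-- The action of `b : B` on the bimodule `D`, as an endomorphism of the `A`-module `D`. -/
def actHom (A : Type u) [Ring A] (B : Type u) [Ring B] (D : Type u) [AddCommGroup D]
    [Module A D] [Module B D] [SMulCommClass B A D] (b : B) :
    ModuleCat.of A D ⟶ ModuleCat.of A D :=
  ModuleCat.ofHom (Module.toModuleEnd A D b)

/-- The `B`-module structure on `Ext_A^i(M, D)` induced by functoriality in `D`: an element `b`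
acts as `Ext_A^i(M, b)`, where `b` is regarded as an endomorphism of the `A`-module `D`. -/
@[reducible]
def extModule (A : Type u) [Ring A] (B : Type u) [Ring B] (D : Type u) [AddCommGroup D]
    [Module A D] [Module B D] [SMulCommClass B A D] (M : ModuleCat.{u} A) (i : ℕ) :
    Module B (Ext.{u} M (ModuleCat.of A D) i) where
  smul b x := x.comp (Ext.mk₀ (actHom A B D b)) (add_zero i)
  one_smul x := by
    have h : actHom A B D 1 = 𝟙 _ := by ext d; simp [actHom]
    change x.comp (Ext.mk₀ (actHom A B D 1)) (add_zero i) = x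
    rw [h, Ext.comp_mk₀_id]
  mul_smul b c x := by
    have h : actHom A B D (b * c) = actHom A B D c ≫ actHom A B D b := by
      ext d; simp [actHom, mul_smul]
    change x.comp (Ext.mk₀ (actHom A B D (b * c))) (add_zero i) =
      (x.comp (Ext.mk₀ (actHom A B D c)) (add_zero i)).comp
        (Ext.mk₀ (actHom A B D b)) (add_zero i)
    rw [h, Ext.comp_assoc_of_third_deg_zero, Ext.mk₀_comp_mk₀]
  smul_zero b := by
    change (0 : Ext.{u} M (ModuleCat.of A D) i).comp (Ext.mk₀ (actHom A B D b)) (add_zero i) = 0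
    rw [Ext.zero_comp]
  smul_add b x y := by
    change (x + y).comp (Ext.mk₀ (actHom A B D b)) (add_zero i) =
      x.comp (Ext.mk₀ (actHom A B D b)) (add_zero i) +
        y.comp (Ext.mk₀ (actHom A B D b)) (add_zero i)
    rw [Ext.add_comp]
  add_smul b c x := by
    have h : actHom A B D (b + c) = actHom A B D b + actHom A B D c := by
      ext d; simp [actHom, add_smul]
    change x.comp (Ext.mk₀ (actHom A B D (b + c))) (add_zero i) =
      x.comp (Ext.mk₀ (actHom A B D b)) (add_zero i) +
        x.comp (Ext.mk₀ (actHom A B D c)) (add_zero i)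
    rw [h, Ext.mk₀_add, Ext.comp_add]
  zero_smul x := by
    have h : actHom A B D 0 = 0 := by ext d; simp [actHom]
    change x.comp (Ext.mk₀ (actHom A B D 0)) (add_zero i) = 0
    rw [h, Ext.mk₀_zero, Ext.comp_zero]

instance ExtD.instModule (A : Type u) [Ring A] (B : Type u) [Ring B] (D : Type u)
    [AddCommGroup D] [Module A D] [Module B D] [SMulCommClass B A D] (M : ModuleCat.{u} A)
    (i : ℕ) : Module B (ExtD A D M i) :=
  extModule A B D M i

/-- The grade of an `A`-module `N` with respect to `D`: the infimum of the integers `i` with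
`Ext_A^i(N, D) ≠ 0`, which is `⊤` if there is no such `i`. -/
def grade (A : Type u) [Ring A] (D : Type u) [AddCommGroup D] [Module A D]
    (N : ModuleCat.{u} A) : ℕ∞ :=
  ⨅ (i : ℕ) (_ : Nontrivial (ExtD A D N i)), (i : ℕ∞)

/-- A resolution of `M` by finitely generated projective modules. -/
structure FGResolution {A : Type u} [Ring A] (M : ModuleCat.{u} A)
    extends ProjectiveResolution M where
  finite : ∀ i : ℕ, Module.Finite A (complex.X i)

/-- The `i`th syzygy of `M` with respect to a projective resolution `(P_•, ∂_•)`: it is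
`Im (∂_i : P_i → P_{i-1})` for `i ≥ 1`, and `Im (∂_0 : P_0 → M) = M` for `i = 0`. -/
def FGResolution.syzygy {A : Type u} [Ring A] {M : ModuleCat.{u} A} (P : FGResolution M) :
    ℕ → ModuleCat.{u} A
  | 0 => M
  | i + 1 => ModuleCat.of A (LinearMap.range (P.complex.d (i + 1) i).hom)

/-- A presentation `P₁ → P₀ → X → 0` of `X` by finitely generated projective modules. -/
structure FGPresentation {A : Type u} [Ring A] (X : ModuleCat.{u} A) where
  P₁ : ModuleCat.{u} A
  P₀ : ModuleCat.{u} A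
  d : P₁ →ₗ[A] P₀
  π : P₀ →ₗ[A] X
  finite₁ : Module.Finite A P₁
  finite₀ : Module.Finite A P₀
  projective₁ : Module.Projective A P₁
  projective₀ : Module.Projective A P₀
  exact : Function.Exact d π
  surjective : Function.Surjective π

/-- The (Auslander) transpose of `X` with respect to a projective presentation
`P₁ → P₀ → X → 0`, namely the cokernel of the `B`-linear map
`Hom_A(P₀, D) → Hom_A(P₁, D)` dual to `P₁ → P₀`. -/
def FGPresentation.transpose {A : Type u} [Ring A] {X : ModuleCat.{u} A} (Q : FGPresentation X)
    (B : Type u) [Ring B] (D : Type u) [AddCommGroup D] [Module A D] [Module B D]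
    [SMulCommClass A B D] : ModuleCat.{u} B :=
  ModuleCat.of B ((Q.P₁ →ₗ[A] D) ⧸ LinearMap.range (LinearMap.lcomp B D Q.d))

/-- `IsTorsionfree R m X` says that the right `R`-module `X` belongs to `TF_m(R)`: it is finitely
generated, and `Ext_{Rᵒᵖ}^l(Tr X, R) = 0` for `1 ≤ l ≤ m`, where `Tr X` is the transpose with
respect to any presentation of `X` by finitely generated projective modules. -/
def IsTorsionfree (R : Type u) [Ring R] (m : ℕ) (X : ModuleCat.{u} Rᵐᵒᵖ) : Prop :=
  Module.Finite Rᵐᵒᵖ X ∧ ∀ (Q : FGPresentation X) (l : ℕ), 1 ≤ l → l ≤ m →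
    Subsingleton (ExtD R R (Q.transpose R R) l)

end

end StableModule

namespace StableModule

noncomputable section

/-! Let `0 → Y → P → X → 0` be exact with `P` finitely generated projective (here `X = Ω^i M`, `Y =
Ω^{i+1} M`), and let `P₂ → P₁ → Y → 0` present `Y`. Splicing presents `X` by `P₁ → P`. With `I` the
image of `P₁^* → P₂^*`, there are exact sequences `0 → I → P₂^* → Tr Y → 0` and `0 → Ext^1(X, R) →
Tr X → I → 0`. The first gives `Ext^{l+1}(Tr Y, R) ≅ Ext^l(I, R)` for `l ≥ 1`. The second maps this
to `Ext^l(Tr X, R)`, injectively if `Ext^{l-1}(Ext^1(X, R), R) = 0` and surjectively if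
`Ext^l(Ext^1(X, R), R) = 0`.

Since `Ext^1(Ω^i M, R) ≅ Ext^{i+1}(M, R)` has grade at least `N = i + j`, the map is injective for
`l ≤ N` and bijective for `l < N` (`exists_extD_transpose_injective`). This gives the isomorphisms
and monomorphisms. For torsionfreeness the missing degree is `Ext^1(Tr Y, R)`, which vanishes
because `Y` embeds in a projective (`subsingleton_extD_one_transpose`). -/

theorem subsingleton_extD_of_projective {A : Type u} [Ring A] (D : Type u) [AddCommGroup D]
    [Module A D] (P : ModuleCat.{u} A) [Module.Projective A P] {i : ℕ}
    (hi : 1 ≤ i) : Subsingleton (ExtD A D P i) := by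
  obtain ⟨i, rfl⟩ := Nat.exists_eq_add_of_le' hi
  have : Projective P := (IsProjective.iff_projective P).1 inferInstance
  exact subsingleton_of_forall_eq 0 Ext.eq_zero_of_projective

/-! ### Functoriality and long exact sequences of `Ext(-, D)`, linearly over `B`. -/

section Ext

variable {A : Type u} [Ring A] (B : Type u) [Ring B] (D : Type u) [AddCommGroup D]
  [Module A D] [Module B D] [SMulCommClass B A D]

/-- Composition with an extension class, as a `B`-linear map between the groups `Ext_A^i(-, D)`. -/
def extPrecomp {M N : ModuleCat.{u} A} {a p q : ℕ} (α : Ext.{u} M N a) (h : a + p = q) :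
    ExtD A D N p →ₗ[B] ExtD A D M q where
  toFun x := α.comp (show Ext.{u} N (ModuleCat.of A D) p from x) h
  map_add' x y := Ext.comp_add α x y h
  map_smul' b x := (Ext.comp_assoc_of_third_deg_zero α x (Ext.mk₀ (actHom A B D b)) h).symm

/-- The contravariant functoriality of `Ext_A^i(-, D)`. -/
def extMap {M N : ModuleCat.{u} A} (f : M ⟶ N) (i : ℕ) : ExtD A D N i →ₗ[B] ExtD A D M i :=
  extPrecomp B D (Ext.mk₀ f) (zero_add i)

theorem extMap_id (M : ModuleCat.{u} A) (i : ℕ) : extMap B D (𝟙 M) i = LinearMap.id :=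
  LinearMap.ext fun x ↦ Ext.mk₀_id_comp (show Ext.{u} M (ModuleCat.of A D) i from x)

theorem extMap_comp {M N K : ModuleCat.{u} A} (f : M ⟶ N) (g : N ⟶ K) (i : ℕ) :
    extMap B D (f ≫ g) i = extMap B D f i ∘ₗ extMap B D g i :=
  LinearMap.ext fun x ↦
    (Ext.mk₀_comp_mk₀_assoc f g (show Ext.{u} K (ModuleCat.of A D) i from x)).symm

theorem extMap_add {M N : ModuleCat.{u} A} (f g : M ⟶ N) (i : ℕ) :
    extMap B D (f + g) i = extMap B D f i + extMap B D g i :=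
  LinearMap.ext fun x ↦ by
    change (Ext.mk₀ (f + g)).comp (show Ext.{u} N (ModuleCat.of A D) i from x) (zero_add i) = _
    rw [Ext.mk₀_add, Ext.add_comp]; rfl

/-- The linear equivalence on `Ext_A^i(-, D)` induced by a pair of morphisms whose composites
induce the identity. -/
theorem nonempty_extD_equiv {M N : ModuleCat.{u} A} (f : M ⟶ N) (g : N ⟶ M) (i : ℕ)
    (h₁ : extMap B D (f ≫ g) i = LinearMap.id) (h₂ : extMap B D (g ≫ f) i = LinearMap.id) :
    Nonempty (ExtD A D M i ≃ₗ[B] ExtD A D N i) :=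
  ⟨LinearEquiv.ofLinearMap (extMap B D g i) (extMap B D f i) (by rw [← extMap_comp, h₂])
    (by rw [← extMap_comp, h₁])⟩

/-- A map factoring through a projective acts as zero on positive `Ext`. This is what makes `Ext` of
the transpose independent of choices. -/
theorem extMap_eq_id_of_factors {M P : ModuleCat.{u} A} [Module.Projective A P] (f : M ⟶ M)
    (a : M ⟶ P) (b : P ⟶ M) (h : f = 𝟙 M + a ≫ b) {i : ℕ} (hi : 1 ≤ i) :
    extMap B D f i = LinearMap.id := by
  have := subsingleton_extD_of_projective D P hi
  rw [h, extMap_add, extMap_id, extMap_comp, Subsingleton.elim (extMap B D b i) 0,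
    LinearMap.comp_zero, add_zero]

/-- Dimension shifting. -/
theorem nonempty_extD_equiv_succ {S : ShortComplex (ModuleCat.{u} A)} (hS : S.ShortExact)
    [Module.Projective A S.X₂] {i : ℕ} (hi : 1 ≤ i) :
    Nonempty (ExtD A D S.X₁ i ≃ₗ[B] ExtD A D S.X₃ (i + 1)) := by
  have h0 := subsingleton_extD_of_projective D S.X₂ hi
  have h1 := subsingleton_extD_of_projective D S.X₂ (hi.trans i.le_succ)
  refine ⟨LinearEquiv.ofBijective (extPrecomp B D hS.extClass (add_comm 1 i)) ⟨?_, ?_⟩⟩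
  · rw [← LinearMap.ker_eq_bot, LinearMap.ker_eq_bot']
    intro x hx
    obtain ⟨y, hy⟩ := Ext.contravariant_sequence_exact₁ hS (ModuleCat.of A D) x (add_comm 1 i) hx
    rw [← hy, show y = 0 from h0.elim _ _, Ext.comp_zero]
    rfl
  · intro x
    exact Ext.contravariant_sequence_exact₃ hS (ModuleCat.of A D) x (h1.elim _ _) (add_comm 1 i)

theorem extMap_injective {S : ShortComplex (ModuleCat.{u} A)} (hS : S.ShortExact) {i : ℕ}
    (h : Subsingleton (ExtD A D S.X₁ i)) : Function.Injective (extMap B D S.g (i + 1)) := by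
  rw [← LinearMap.ker_eq_bot, LinearMap.ker_eq_bot']
  intro x hx
  obtain ⟨y, hy⟩ := Ext.contravariant_sequence_exact₃ hS (ModuleCat.of A D) x hx (add_comm 1 i)
  rw [← hy, show y = 0 from h.elim _ _, Ext.comp_zero]
  rfl

theorem extMap_surjective {S : ShortComplex (ModuleCat.{u} A)} (hS : S.ShortExact) {i : ℕ}
    (h : Subsingleton (ExtD A D S.X₁ i)) : Function.Surjective (extMap B D S.g i) := fun x ↦
  Ext.contravariant_sequence_exact₂ hS (ModuleCat.of A D) x (h.elim _ _)

/-- The connecting map `Hom_A(Y, D) → Ext_A^1(X, D)` of a short exact sequence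
`0 → Y → P → X → 0`. -/
def homToExt {S : ShortComplex (ModuleCat.{u} A)} (hS : S.ShortExact) :
    letI : SMulCommClass A B D := SMulCommClass.symm B A D
    (S.X₁ →ₗ[A] D) →ₗ[B] ExtD A D S.X₃ 1 :=
  letI : SMulCommClass A B D := SMulCommClass.symm B A D
  { toFun := fun φ ↦ hS.extClass.comp (Ext.mk₀ (ModuleCat.ofHom (Y := D) φ)) (add_zero 1)
    map_add' := fun φ ψ ↦ by rw [ModuleCat.ofHom_add, Ext.mk₀_add, Ext.comp_add]; rfl
    map_smul' := fun b φ ↦ by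
      have : ModuleCat.ofHom (b • φ) = ModuleCat.ofHom φ ≫ actHom A B D b := rfl
      rw [this, ← Ext.mk₀_comp_mk₀, ← Ext.comp_assoc_of_third_deg_zero]
      rfl }

theorem homToExt_surjective {S : ShortComplex (ModuleCat.{u} A)} (hS : S.ShortExact)
    [Module.Projective A S.X₂] : Function.Surjective (homToExt B D hS) := fun x ↦ by
  have h1 := subsingleton_extD_of_projective D S.X₂ le_rfl
  obtain ⟨y, hy⟩ :=
    Ext.contravariant_sequence_exact₃ hS (ModuleCat.of A D) x (h1.elim _ _) (add_zero 1)
  obtain ⟨φ, rfl⟩ := (Ext.mk₀_bijective _ _).2 y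
  exact ⟨φ.hom, hy⟩

theorem homToExt_eq_zero_iff {S : ShortComplex (ModuleCat.{u} A)} (hS : S.ShortExact)
    (φ : S.X₁ →ₗ[A] D) : homToExt B D hS φ = 0 ↔ ∃ ψ : S.X₂ →ₗ[A] D, ψ ∘ₗ S.f.hom = φ := by
  constructor
  · intro h
    obtain ⟨y, hy⟩ := Ext.contravariant_sequence_exact₁ hS (ModuleCat.of A D)
      (Ext.mk₀ (ModuleCat.ofHom (Y := D) φ)) (add_zero 1) h
    obtain ⟨ψ, rfl⟩ := (Ext.mk₀_bijective _ _).2 y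
    rw [Ext.mk₀_comp_mk₀] at hy
    exact ⟨ψ.hom, congrArg ModuleCat.Hom.hom ((Ext.mk₀_bijective _ _).1 hy)⟩
  · rintro ⟨ψ, rfl⟩
    change hS.extClass.comp (Ext.mk₀ (ModuleCat.ofHom (Y := D) (ψ ∘ₗ S.f.hom))) (add_zero 1) = _
    have : ModuleCat.ofHom (Y := D) (ψ ∘ₗ S.f.hom) = S.f ≫ ModuleCat.ofHom (Y := D) ψ := rfl
    rw [this, ← Ext.mk₀_comp_mk₀, ShortComplex.ShortExact.extClass_comp_assoc]
    rfl

end Ext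

theorem subsingleton_extD_of_lt_grade {A : Type u} [Ring A] {D : Type u} [AddCommGroup D]
    [Module A D] {N : ModuleCat.{u} A} {i : ℕ} (h : (i : ℕ∞) < grade A D N) :
    Subsingleton (ExtD A D N i) := by
  by_contra hn
  rw [not_subsingleton_iff_nontrivial] at hn
  exact absurd (iInf₂_le i hn) (not_le.2 h)

/-- The short complex of an exact pair of linear maps. -/
abbrev exactComplex {A : Type u} [Ring A] {X Y Z : Type u} [AddCommGroup X] [AddCommGroup Y]
    [AddCommGroup Z] [Module A X] [Module A Y] [Module A Z] (f : X →ₗ[A] Y) (g : Y →ₗ[A] Z)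
    (h : Function.Exact f g) : ShortComplex (ModuleCat.{u} A) :=
  ShortComplex.mk (ModuleCat.ofHom f) (ModuleCat.ofHom g)
    (by ext x; exact h.apply_apply_eq_zero x)

theorem shortExact_of_linearMap {A : Type u} [Ring A] {X Y Z : Type u} [AddCommGroup X]
    [AddCommGroup Y] [AddCommGroup Z] [Module A X] [Module A Y] [Module A Z] (f : X →ₗ[A] Y)
    (g : Y →ₗ[A] Z) (hf : Function.Injective f) (hg : Function.Surjective g)
    (h : Function.Exact f g) :
    (exactComplex f g h).ShortExact where
  exact := (ShortComplex.ShortExact.moduleCat_exact_iff_function_exact _).2 h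
  mono_f := (ModuleCat.mono_iff_injective _).2 hf
  epi_g := (ModuleCat.epi_iff_surjective _).2 hg

/-! ### Lifting, factoring, and duals of finitely generated projectives. -/

section Linear

variable {A : Type u} [Ring A]

theorem exists_lift_of_exact {P M N K : Type u} [AddCommGroup P] [AddCommGroup M]
    [AddCommGroup N] [AddCommGroup K] [Module A P] [Module A M] [Module A N] [Module A K]
    [Module.Projective A P] {g : M →ₗ[A] N} {h : N →ₗ[A] K} (hgh : Function.Exact g h)
    (f : P →ₗ[A] N) (hf : h ∘ₗ f = 0) : ∃ l : P →ₗ[A] M, g ∘ₗ l = f := by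
  have hr : ∀ p, f p ∈ LinearMap.range g := fun p ↦ (hgh (f p)).1 (LinearMap.congr_fun hf p)
  obtain ⟨l, hl⟩ := Module.projective_lifting_property g.rangeRestrict
    (f.codRestrict (LinearMap.range g) hr) g.surjective_rangeRestrict
  exact ⟨l, LinearMap.ext fun p ↦ congrArg Subtype.val (LinearMap.congr_fun hl p)⟩

theorem exists_factor_of_exact {M N K L : Type u} [AddCommGroup M] [AddCommGroup N]
    [AddCommGroup K] [AddCommGroup L] [Module A M] [Module A N] [Module A K] [Module A L]
    {g : M →ₗ[A] N} {h : N →ₗ[A] K} (hgh : Function.Exact g h) (hh : Function.Surjective h)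
    (f : N →ₗ[A] L) (hf : f ∘ₗ g = 0) : ∃ l : K →ₗ[A] L, l ∘ₗ h = f := by
  have hk : LinearMap.ker h ≤ LinearMap.ker f := by
    intro x hx
    obtain ⟨y, rfl⟩ := (hgh x).1 hx
    exact LinearMap.congr_fun hf y
  refine ⟨(LinearMap.ker h).liftQ f hk ∘ₗ (h.quotKerEquivOfSurjective hh).symm.toLinearMap,
    LinearMap.ext fun x ↦ ?_⟩
  have : (h.quotKerEquivOfSurjective hh).symm (h x) = (LinearMap.ker h).mkQ x := by
    rw [LinearEquiv.symm_apply_eq]; rfl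
  simp only [LinearMap.comp_apply, LinearEquiv.coe_coe, this]
  rfl

/-- A finitely generated projective module is a retract of a finite free module. -/
theorem exists_retract_of_finite_projective (P : Type u) [AddCommGroup P] [Module A P]
    [Module.Finite A P] [Module.Projective A P] :
    ∃ (n : ℕ) (f : (Fin n → A) →ₗ[A] P) (s : P →ₗ[A] Fin n → A), f ∘ₗ s = LinearMap.id := by
  obtain ⟨n, f, hf⟩ := Module.Finite.exists_fin' A P
  obtain ⟨s, hs⟩ := Module.projective_lifting_property f LinearMap.id hf
  exact ⟨n, f, s, hs⟩

/-- Dualising a retraction of `A^n` onto `P` makes `Hom_A(P, D)` a retract of `D^n`. -/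
theorem projective_hom (B D P : Type u) [Ring B] [AddCommGroup D] [Module A D] [Module B D]
    [SMulCommClass A B D] [Module.Projective B D] [AddCommGroup P] [Module A P]
    [Module.Finite A P] [Module.Projective A P] : Module.Projective B (P →ₗ[A] D) := by
  obtain ⟨n, f, s, hfs⟩ := exists_retract_of_finite_projective (A := A) P
  have : Module.Projective B ((Fin n → A) →ₗ[A] D) :=
    Module.Projective.of_equiv ((DFinsupp.linearEquivFunOnFintype (M := fun _ : Fin n ↦ D)).trans
      (LinearEquiv.piRing A D (Fin n) B).symm)
  refine Module.Projective.of_split (LinearMap.lcomp B D f) (LinearMap.lcomp B D s)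
    (LinearMap.ext fun φ ↦ ?_)
  change (φ ∘ₗ f) ∘ₗ s = φ
  rw [LinearMap.comp_assoc, hfs, LinearMap.comp_id]

end Linear

/-! ### Dual bases and reflexivity over `R`. -/

section Dual

variable {R : Type u} [Ring R] {P : Type u} [AddCommGroup P] [Module Rᵐᵒᵖ P]

/-- The underlying element of `R`, as an `Rᵐᵒᵖ`-linear map. -/
def unopHom (R : Type u) [Ring R] : Rᵐᵒᵖ →ₗ[Rᵐᵒᵖ] R where
  toFun := MulOpposite.unop
  map_add' _ _ := rfl
  map_smul' _ _ := rfl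

variable (P) in
/-- The dual basis lemma for finitely generated projective right modules. -/
theorem exists_dual_basis [Module.Finite Rᵐᵒᵖ P] [Module.Projective Rᵐᵒᵖ P] :
    ∃ (n : ℕ) (e : Fin n → P) (c : Fin n → P →ₗ[Rᵐᵒᵖ] R),
      ∀ x, ∑ i, MulOpposite.op (c i x) • e i = x := by
  obtain ⟨n, f, s, hfs⟩ := exists_retract_of_finite_projective (A := Rᵐᵒᵖ) P
  refine ⟨n, fun i ↦ f (Pi.single i 1), fun i ↦ unopHom R ∘ₗ LinearMap.proj i ∘ₗ s, fun x ↦ ?_⟩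
  conv_rhs => rw [← LinearMap.id_apply (R := Rᵐᵒᵖ) x, ← hfs, LinearMap.comp_apply,
    ← LinearMap.sum_single_apply _ (s x), map_sum]
  refine Finset.sum_congr rfl fun i _ ↦ ?_
  rw [← map_smul]
  congr 1
  ext k
  simp [unopHom, Pi.single_apply]

theorem exists_hom_ne_zero [Module.Finite Rᵐᵒᵖ P] [Module.Projective Rᵐᵒᵖ P] {x : P}
    (h : ∀ ψ : P →ₗ[Rᵐᵒᵖ] R, ψ x = 0) : x = 0 := by
  obtain ⟨n, e, c, hec⟩ := exists_dual_basis (R := R) P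
  rw [← hec x]
  simp [h]

/-- Finitely generated projective modules are reflexive. -/
theorem exists_eval_eq [Module.Finite Rᵐᵒᵖ P] [Module.Projective Rᵐᵒᵖ P]
    (θ : (P →ₗ[Rᵐᵒᵖ] R) →ₗ[R] R) : ∃ p : P, ∀ ψ, θ ψ = ψ p := by
  obtain ⟨n, e, c, hec⟩ := exists_dual_basis (R := R) P
  refine ⟨∑ i, MulOpposite.op (θ (c i)) • e i, fun ψ ↦ ?_⟩
  have : ψ = ∑ i, ψ (e i) • c i := by
    ext x
    conv_lhs => rw [← hec x]
    simp
  conv_lhs => rw [this]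
  simp

end Dual

/-! ### Independence of the transpose from the presentation. -/

section Transpose

variable {A : Type u} [Ring A] (B : Type u) [Ring B] (D : Type u) [AddCommGroup D]
  [Module A D] [Module B D] [SMulCommClass A B D]

/-- The map on transposes induced by a map of presentations. -/
def transposeMap {X Y : ModuleCat.{u} A} (Q : FGPresentation X) (Q' : FGPresentation Y)
    (f₁ : Q.P₁ →ₗ[A] Q'.P₁) (f₀ : Q.P₀ →ₗ[A] Q'.P₀) (h : Q'.d ∘ₗ f₁ = f₀ ∘ₗ Q.d) :
    Q'.transpose B D ⟶ Q.transpose B D :=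
  ModuleCat.ofHom (Submodule.mapQ _ _ (LinearMap.lcomp B D f₁) (by
    rintro _ ⟨φ, rfl⟩
    refine ⟨φ ∘ₗ f₀, ?_⟩
    change (φ ∘ₗ f₀) ∘ₗ Q.d = (φ ∘ₗ Q'.d) ∘ₗ f₁
    rw [LinearMap.comp_assoc, LinearMap.comp_assoc, h]))

theorem exists_presentation_map {X : ModuleCat.{u} A} (Q Q' : FGPresentation X) :
    ∃ (f₁ : Q.P₁ →ₗ[A] Q'.P₁) (f₀ : Q.P₀ →ₗ[A] Q'.P₀),
      Q'.d ∘ₗ f₁ = f₀ ∘ₗ Q.d ∧ Q'.π ∘ₗ f₀ = Q.π := by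
  have := Q.projective₀
  have := Q.projective₁
  obtain ⟨f₀, h₀⟩ := Module.projective_lifting_property Q'.π Q.π Q'.surjective
  obtain ⟨f₁, h₁⟩ := exists_lift_of_exact Q'.exact (f₀ ∘ₗ Q.d) (by
    rw [← LinearMap.comp_assoc, h₀]; exact Q.exact.linearMap_comp_eq_zero)
  exact ⟨f₁, f₀, h₁, h₀⟩

/-- An endomorphism of a presentation lifting the identity of `X` is homotopic to the identity up to
a map `k` with `d k = 0`: `e₀ - 1 = d s` and `e₁ - 1 = s d + k`. Dually, `s d` dies in the cokernel
of `d^*`, while `k` contributes a map factoring through the projective `P₁^*`. -/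
theorem extMap_transposeMap_self [Module.Projective B D] {X : ModuleCat.{u} A}
    (Q : FGPresentation X) (e₁ : Q.P₁ →ₗ[A] Q.P₁) (e₀ : Q.P₀ →ₗ[A] Q.P₀)
    (h : Q.d ∘ₗ e₁ = e₀ ∘ₗ Q.d) (hπ : Q.π ∘ₗ e₀ = Q.π) {l : ℕ} (hl : 1 ≤ l) :
    extMap A D (transposeMap B D Q Q e₁ e₀ h) l = LinearMap.id := by
  have := Q.projective₀
  have := Q.projective₁
  have := Q.finite₁
  have := projective_hom (A := A) B D Q.P₁
  obtain ⟨s, hs⟩ := exists_lift_of_exact Q.exact (e₀ - LinearMap.id) (by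
    rw [LinearMap.comp_sub, hπ, LinearMap.comp_id, sub_self])
  let k := e₁ - LinearMap.id - s ∘ₗ Q.d
  have hk : Q.d ∘ₗ k = 0 := by
    simp only [k, LinearMap.comp_sub, h, ← LinearMap.comp_assoc, hs, LinearMap.sub_comp,
      LinearMap.comp_id, LinearMap.id_comp, sub_self]
  refine extMap_eq_id_of_factors A D (P := ModuleCat.of B (Q.P₁ →ₗ[A] D)) _
    (ModuleCat.ofHom ((LinearMap.range (LinearMap.lcomp B D Q.d)).liftQ (LinearMap.lcomp B D k) ?_))
    (ModuleCat.ofHom (LinearMap.range (LinearMap.lcomp B D Q.d)).mkQ) ?_ hl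
  · rintro _ ⟨φ, rfl⟩
    change (φ ∘ₗ Q.d) ∘ₗ k = 0
    rw [LinearMap.comp_assoc, hk, LinearMap.comp_zero]
  · ext x
    obtain ⟨φ, rfl⟩ := Submodule.mkQ_surjective _ x
    change (LinearMap.range (LinearMap.lcomp B D Q.d)).mkQ (φ ∘ₗ e₁) =
      (LinearMap.range (LinearMap.lcomp B D Q.d)).mkQ φ +
        (LinearMap.range (LinearMap.lcomp B D Q.d)).mkQ (φ ∘ₗ k)
    rw [← map_add, Submodule.mkQ_apply, Submodule.mkQ_apply, Submodule.Quotient.eq]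
    refine ⟨φ ∘ₗ s, ?_⟩
    change (φ ∘ₗ s) ∘ₗ Q.d = φ ∘ₗ e₁ - (φ + φ ∘ₗ k)
    simp only [k, LinearMap.comp_sub, LinearMap.comp_id, LinearMap.comp_assoc]
    abel

/-- `Ext^l(Tr X, D)` does not depend on the presentation of `X` for `l ≥ 1`. -/
theorem nonempty_extD_transpose_equiv [Module.Projective B D] {X : ModuleCat.{u} A}
    (Q Q' : FGPresentation X) {l : ℕ} (hl : 1 ≤ l) :
    Nonempty (ExtD B D (Q.transpose B D) l ≃ₗ[A] ExtD B D (Q'.transpose B D) l) := by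
  obtain ⟨f₁, f₀, hf, hfπ⟩ := exists_presentation_map Q Q'
  obtain ⟨g₁, g₀, hg, hgπ⟩ := exists_presentation_map Q' Q
  -- Stated for an arbitrary pair of presentations so that it covers both composites.
  have comp : ∀ {Q Q' : FGPresentation X} (f₁ : Q.P₁ →ₗ[A] Q'.P₁) (f₀ : Q.P₀ →ₗ[A] Q'.P₀)
      (hf : Q'.d ∘ₗ f₁ = f₀ ∘ₗ Q.d) (_ : Q'.π ∘ₗ f₀ = Q.π)
      (g₁ : Q'.P₁ →ₗ[A] Q.P₁) (g₀ : Q'.P₀ →ₗ[A] Q.P₀) (hg : Q.d ∘ₗ g₁ = g₀ ∘ₗ Q'.d)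
      (_ : Q.π ∘ₗ g₀ = Q'.π), extMap A D (transposeMap B D Q' Q g₁ g₀ hg ≫
        transposeMap B D Q Q' f₁ f₀ hf) l = LinearMap.id := by
    intro Q Q' f₁ f₀ hf hfπ g₁ g₀ hg hgπ
    rw [← extMap_transposeMap_self B D Q (g₁ ∘ₗ f₁) (g₀ ∘ₗ f₀) (by
      rw [← LinearMap.comp_assoc, hg, LinearMap.comp_assoc, hf, LinearMap.comp_assoc]) (by
      rw [← LinearMap.comp_assoc, hgπ, hfπ]) hl]
    congr 1
    ext x
    obtain ⟨φ, rfl⟩ := Submodule.mkQ_surjective _ x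
    rfl
  exact nonempty_extD_equiv A D (transposeMap B D Q' Q g₁ g₀ hg)
    (transposeMap B D Q Q' f₁ f₀ hf) l (comp _ _ _ hfπ _ _ _ hgπ) (comp _ _ _ hgπ _ _ _ hfπ)

end Transpose

theorem subsingleton_extD_of_equiv {B : Type u} [Ring B] (D : Type u) [AddCommGroup D]
    [Module B D] {M N : Type u} [AddCommGroup M] [AddCommGroup N] [Module B M]
    [Module B N] (e : M ≃ₗ[B] N) {l : ℕ} (h : Subsingleton (ExtD B D (ModuleCat.of B M) l)) :
    Subsingleton (ExtD B D (ModuleCat.of B N) l) := by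
  have hid : ModuleCat.ofHom e.symm.toLinearMap ≫ ModuleCat.ofHom e.toLinearMap = 𝟙 _ := by
    ext x; simp
  refine subsingleton_of_forall_eq 0 fun x ↦ ?_
  let x' : Ext.{u} (ModuleCat.of B N) (ModuleCat.of B D) l := x
  have h0 : (Ext.mk₀ (ModuleCat.ofHom e.toLinearMap)).comp x' (zero_add l) = 0 := h.elim _ _
  change x' = 0
  rw [← Ext.mk₀_id_comp x', ← hid, ← Ext.mk₀_comp_mk₀_assoc, h0, Ext.comp_zero]

/-! ### The two exact sequences relating `Tr X`, `Tr Y` and `Ext^1(X, D)`. -/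

section ShortExact

variable {A : Type u} [Ring A] (B : Type u) [Ring B] (D : Type u) [AddCommGroup D]
  [Module A D] [Module B D] [SMulCommClass A B D]

theorem shortExact_transpose {Y : ModuleCat.{u} A} (Q' : FGPresentation Y) :
    (exactComplex (LinearMap.range (LinearMap.lcomp B D Q'.d)).subtype
      (LinearMap.range (LinearMap.lcomp B D Q'.d)).mkQ (LinearMap.exact_subtype_mkQ _)).ShortExact :=
  shortExact_of_linearMap (LinearMap.range (LinearMap.lcomp B D Q'.d)).subtype
    (LinearMap.range (LinearMap.lcomp B D Q'.d)).mkQ (Submodule.injective_subtype _)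
    (Submodule.mkQ_surjective _) (LinearMap.exact_subtype_mkQ _)

variable {S : ShortComplex (ModuleCat.{u} A)} (hS : S.ShortExact)

include hS in
theorem exact_comp_of_shortExact (Q' : FGPresentation S.X₁) :
    Function.Exact (S.f.hom ∘ₗ Q'.π) S.g.hom := by
  have hfg := (ShortComplex.ShortExact.moduleCat_exact_iff_function_exact _).1 hS.exact
  intro x
  refine (hfg x).trans ⟨?_, ?_⟩
  · rintro ⟨y, rfl⟩
    obtain ⟨z, rfl⟩ := Q'.surjective y
    exact ⟨z, rfl⟩
  · rintro ⟨z, rfl⟩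
    exact ⟨Q'.π z, rfl⟩

variable [Module.Finite A S.X₂] [Module.Projective A S.X₂]

/-- The presentation of `X` obtained by splicing a short exact sequence `0 → Y → P → X → 0` and a
presentation of `Y`. -/
def splice (Q' : FGPresentation S.X₁) : FGPresentation S.X₃ where
  P₁ := Q'.P₀
  P₀ := S.X₂
  d := S.f.hom ∘ₗ Q'.π
  π := S.g.hom
  finite₁ := Q'.finite₀
  finite₀ := inferInstance
  projective₁ := Q'.projective₀
  projective₀ := inferInstance
  exact := exact_comp_of_shortExact hS Q'
  surjective := (ModuleCat.epi_iff_surjective _).1 hS.epi_g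

/-- The map from `Tr X` onto the image of `P₁^* → P₂^*`. -/
def spliceMap (Q' : FGPresentation S.X₁) :
    (splice hS Q').transpose B D →ₗ[B] LinearMap.range (LinearMap.lcomp B D Q'.d) :=
  (LinearMap.range (LinearMap.lcomp B D (splice hS Q').d)).liftQ
    (LinearMap.lcomp B D Q'.d).rangeRestrict (by
      rintro _ ⟨φ, rfl⟩
      refine Subtype.ext ?_
      ext x
      change φ (S.f.hom (Q'.π (Q'.d x))) = 0
      rw [Q'.exact.apply_apply_eq_zero, map_zero]
      exact map_zero φ)

theorem spliceMap_surjective (Q' : FGPresentation S.X₁) :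
    Function.Surjective (spliceMap B D hS Q') := by
  intro y
  obtain ⟨φ, rfl⟩ := LinearMap.surjective_rangeRestrict _ y
  exact ⟨Submodule.Quotient.mk φ, rfl⟩

/-- The map `Y^* → Tr X`. -/
def homToTranspose (Q' : FGPresentation S.X₁) :
    (S.X₁ →ₗ[A] D) →ₗ[B] (splice hS Q').transpose B D :=
  (LinearMap.range (LinearMap.lcomp B D (splice hS Q').d)).mkQ ∘ₗ LinearMap.lcomp B D Q'.π

theorem homToTranspose_eq_zero_iff (Q' : FGPresentation S.X₁) (φ : S.X₁ →ₗ[A] D) :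
    homToTranspose B D hS Q' φ = 0 ↔ ∃ ψ : S.X₂ →ₗ[A] D, ψ ∘ₗ S.f.hom = φ := by
  refine (Submodule.Quotient.mk_eq_zero _).trans (exists_congr fun ψ ↦ ?_)
  change (show S.X₂ →ₗ[A] D from ψ) ∘ₗ S.f.hom ∘ₗ Q'.π = φ ∘ₗ Q'.π ↔ _
  exact LinearMap.cancel_right (f := (show S.X₂ →ₗ[A] D from ψ) ∘ₗ S.f.hom) Q'.surjective

/-- A functional on `Q'.P₀` that vanishes on the image of `Q'.d` is one that factors through `Y =
S.X₁`. -/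
theorem range_homToTranspose (Q' : FGPresentation S.X₁) :
    LinearMap.range (homToTranspose B D hS Q') = LinearMap.ker (spliceMap B D hS Q') := by
  refine le_antisymm ?_ fun x hx ↦ ?_
  · rintro _ ⟨φ, rfl⟩
    refine Subtype.ext ?_
    change (φ ∘ₗ Q'.π) ∘ₗ Q'.d = 0
    rw [LinearMap.comp_assoc, Q'.exact.linearMap_comp_eq_zero, LinearMap.comp_zero]
  · obtain ⟨χ, rfl⟩ := Submodule.mkQ_surjective _ x
    obtain ⟨φ, hφ⟩ := exists_factor_of_exact Q'.exact Q'.surjective χ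
      (congrArg Subtype.val (LinearMap.mem_ker.1 hx))
    exact ⟨φ, congrArg _ hφ⟩

/-- The kernel of `Tr X → P₂^*` is `Ext^1(X, D)`. -/
theorem nonempty_ext_equiv_ker_spliceMap [SMulCommClass B A D] (Q' : FGPresentation S.X₁) :
    Nonempty (ExtD A D S.X₃ 1 ≃ₗ[B] LinearMap.ker (spliceMap B D hS Q')) := by
  -- Both kernels consist of the maps `Y → D` that extend to `S.X₂`, so both images are the same
  -- quotient of `Hom(Y, D)`.
  have hker : LinearMap.ker (homToExt B D hS) = LinearMap.ker (homToTranspose B D hS Q') := by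
    ext φ
    rw [LinearMap.mem_ker, LinearMap.mem_ker, homToExt_eq_zero_iff, homToTranspose_eq_zero_iff]
  exact ⟨((homToExt B D hS).quotKerEquivOfSurjective (homToExt_surjective B D hS)).symm ≪≫ₗ
    Submodule.quotEquivOfEq _ _ hker ≪≫ₗ (homToTranspose B D hS Q').quotKerEquivRange ≪≫ₗ
    LinearEquiv.ofEq _ _ (range_homToTranspose B D hS Q')⟩

theorem shortExact_spliceMap (Q' : FGPresentation S.X₁) :
    (exactComplex (LinearMap.ker (spliceMap B D hS Q')).subtype (spliceMap B D hS Q')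
      (LinearMap.exact_subtype_ker_map _)).ShortExact :=
  shortExact_of_linearMap (LinearMap.ker (spliceMap B D hS Q')).subtype (spliceMap B D hS Q')
    (Submodule.injective_subtype _) (spliceMap_surjective B D hS Q')
    (LinearMap.exact_subtype_ker_map _)

include hS in
theorem exists_extD_transpose_injective [SMulCommClass B A D] [Module.Projective B D]
    (Q' : FGPresentation S.X₁) (Q : FGPresentation S.X₃) {N : ℕ}
    (h : ∀ l < N, Subsingleton (ExtD B D (ModuleCat.of B (ExtD A D S.X₃ 1)) l))
    {l : ℕ} (hl : 1 ≤ l) (hlN : l ≤ N) :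
    ∃ f : ExtD B D (Q'.transpose B D) (l + 1) →ₗ[A] ExtD B D (Q.transpose B D) l,
      Function.Injective f ∧ (l < N → Function.Surjective f) := by
  have := Q'.finite₁
  have := Q'.projective₁
  have hP := projective_hom (A := A) B D Q'.P₁
  obtain ⟨e⟩ := nonempty_ext_equiv_ker_spliceMap B D hS Q'
  have hE : ∀ l < N, Subsingleton
      (ExtD B D (ModuleCat.of B (LinearMap.ker (spliceMap B D hS Q'))) l) :=
    fun l hl ↦ subsingleton_extD_of_equiv D e (h l hl)
  obtain ⟨e₁⟩ := nonempty_extD_equiv_succ A D (shortExact_transpose B D Q') hl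
  obtain ⟨e₂⟩ := nonempty_extD_transpose_equiv B D (splice hS Q') Q hl
  let g := extMap A D (ModuleCat.ofHom (spliceMap B D hS Q')) l
  refine ⟨e₂.toLinearMap ∘ₗ g ∘ₗ e₁.symm.toLinearMap, ?_, fun hl' ↦ ?_⟩
  · have hg : Function.Injective g := by
      obtain ⟨l, rfl⟩ := Nat.exists_eq_add_of_le' hl
      exact extMap_injective A D (shortExact_spliceMap B D hS Q') (hE l (by omega))
    exact e₂.injective.comp (hg.comp e₁.symm.injective)
  · have hg : Function.Surjective g :=
      extMap_surjective A D (shortExact_spliceMap B D hS Q') (hE l hl')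
    exact e₂.surjective.comp (hg.comp e₁.symm.surjective)

end ShortExact

/-- Submodules of finitely generated projective modules are torsionless. -/
theorem subsingleton_extD_one_transpose {R : Type u} [Ring R] {Y : ModuleCat.{u} Rᵐᵒᵖ}
    {P : Type u} [AddCommGroup P] [Module Rᵐᵒᵖ P] [Module.Finite Rᵐᵒᵖ P]
    [Module.Projective Rᵐᵒᵖ P] (ι : Y →ₗ[Rᵐᵒᵖ] P) (hι : Function.Injective ι)
    (Q : FGPresentation Y) : Subsingleton (ExtD R R (Q.transpose R R) 1) := by
  have := Q.finite₁
  have := Q.projective₁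
  have := Q.finite₀
  have := Q.projective₀
  have hP := projective_hom (A := Rᵐᵒᵖ) R R Q.P₁
  refine subsingleton_of_forall_eq 0 fun x ↦ ?_
  -- The class vanishes once `φ`, defined on the image of `d^*`, extends to `P₁^*`.
  obtain ⟨φ, rfl⟩ := homToExt_surjective Rᵐᵒᵖ R (shortExact_transpose R R Q) x
  refine (homToExt_eq_zero_iff Rᵐᵒᵖ R (shortExact_transpose R R Q) φ).2 ?_
  let I := LinearMap.range (LinearMap.lcomp R R Q.d)
  let φ' : I →ₗ[R] R := φ
  -- By reflexivity, `φ ∘ d^*` is evaluation at some `p` in `P₀`. Functionals pulled back along `ι ∘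
  -- π` are killed by `d^*`, so `ι (π p) = 0` and `p = d q`; evaluation at `q` is the extension.
  obtain ⟨p, hp⟩ := exists_eval_eq (φ' ∘ₗ (LinearMap.lcomp R R Q.d).rangeRestrict)
  have hιp : ι (Q.π p) = 0 := exists_hom_ne_zero fun ψ ↦ by
    change (ψ ∘ₗ ι ∘ₗ Q.π) p = 0
    rw [← hp, LinearMap.comp_apply]
    convert map_zero φ'
    refine Subtype.ext ?_
    change (ψ ∘ₗ ι ∘ₗ Q.π) ∘ₗ Q.d = 0
    rw [LinearMap.comp_assoc, LinearMap.comp_assoc, Q.exact.linearMap_comp_eq_zero,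
      LinearMap.comp_zero, LinearMap.comp_zero]
  obtain ⟨q, rfl⟩ := (Q.exact p).1 (hι (hιp.trans (map_zero ι).symm))
  refine ⟨LinearMap.applyₗ' R q, ?_⟩
  change _ = φ'
  ext ⟨_, χ, rfl⟩
  exact (hp χ).symm

/-! ### Syzygies and torsionfreeness. -/

/-- The short exact sequence `0 → Ω^{i+1} M → P_i → Ω^i M → 0`. -/
theorem FGResolution.exists_shortExact {A : Type u} [Ring A] {M : ModuleCat.{u} A}
    (P : FGResolution M) (i : ℕ) :
    ∃ (f : P.syzygy (i + 1) ⟶ P.complex.X i) (g : P.complex.X i ⟶ P.syzygy i) (w : f ≫ g = 0),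
      (ShortComplex.mk f g w).ShortExact := by
  obtain ⟨g, hg, hfg⟩ : ∃ g : P.complex.X i →ₗ[A] P.syzygy i, Function.Surjective g ∧
      Function.Exact (P.complex.d (i + 1) i).hom g := by
    cases i with
    | zero =>
      exact ⟨(P.π.f 0).hom, (ModuleCat.epi_iff_surjective (P.π.f 0)).1 inferInstance,
        (ShortComplex.ShortExact.moduleCat_exact_iff_function_exact _).1 P.exact₀⟩
    | succ i =>
      have h := (ShortComplex.ShortExact.moduleCat_exact_iff_function_exact _).1 (P.exact_succ i)
      refine ⟨(P.complex.d (i + 1) i).hom.rangeRestrict, LinearMap.surjective_rangeRestrict _,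
        fun x ↦ ?_⟩
      rw [← h x]
      exact Subtype.ext_iff
  have hex : Function.Exact (LinearMap.range (P.complex.d (i + 1) i).hom).subtype g := fun x ↦ by
    rw [hfg x]
    simp
  exact ⟨_, _, _, shortExact_of_linearMap _ g (Submodule.injective_subtype _) hg hex⟩

theorem FGResolution.finite_syzygy {A : Type u} [Ring A] {M : ModuleCat.{u} A}
    (P : FGResolution M) (i : ℕ) : Module.Finite A (P.syzygy i) := by
  obtain ⟨f, g, w, h⟩ := P.exists_shortExact i
  have := P.finite i
  exact Module.Finite.of_surjective g.hom ((ModuleCat.epi_iff_surjective g).1 h.epi_g)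

theorem FGResolution.projective_X {A : Type u} [Ring A] {M : ModuleCat.{u} A}
    (P : FGResolution M) (i : ℕ) : Module.Projective A (P.complex.X i) :=
  (IsProjective.iff_projective _).2 (P.projective i)

/-- Iterated dimension shifting. The case `k = 0` identifies `Ext^1(Ω^i M, D)`; general `k` is there
for the induction. -/
theorem FGResolution.nonempty_extD_equiv {A : Type u} [Ring A] (B D : Type u) [Ring B]
    [AddCommGroup D] [Module A D] [Module B D] [SMulCommClass B A D] {M : ModuleCat.{u} A}
    (P : FGResolution M) (i k : ℕ) :
    Nonempty (ExtD A D (P.syzygy i) (k + 1) ≃ₗ[B] ExtD A D M (i + k + 1)) := by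
  induction i generalizing k with
  | zero => rw [zero_add]; exact ⟨LinearEquiv.refl _ _⟩
  | succ i ih =>
    obtain ⟨f, g, w, h⟩ := P.exists_shortExact i
    have := P.projective_X i
    obtain ⟨e⟩ := nonempty_extD_equiv_succ B D h (i := k + 1) (Nat.le_add_left _ _)
    obtain ⟨e'⟩ := ih (k + 1)
    rw [show i + 1 + k + 1 = i + (k + 1) + 1 by omega]
    exact ⟨e ≪≫ₗ e'⟩

theorem FGResolution.exists_extD_transpose_injective {R : Type u} [Ring R]
    {M : ModuleCat.{u} Rᵐᵒᵖ} (P : FGResolution M) {i N : ℕ}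
    (h : (N : ℕ∞) ≤ grade R R (ModuleCat.of R (ExtD Rᵐᵒᵖ R M (i + 1))))
    (Q : FGPresentation (P.syzygy i)) (Q' : FGPresentation (P.syzygy (i + 1)))
    {l : ℕ} (hl : 1 ≤ l) (hlN : l ≤ N) :
    ∃ f : ExtD R R (Q'.transpose R R) (l + 1) →ₗ[Rᵐᵒᵖ] ExtD R R (Q.transpose R R) l,
      Function.Injective f ∧ (l < N → Function.Surjective f) := by
  obtain ⟨f, g, w, hS⟩ := P.exists_shortExact i
  obtain ⟨e⟩ := P.nonempty_extD_equiv R R i 0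
  have := P.projective_X i
  have := P.finite i
  refine StableModule.exists_extD_transpose_injective R R hS Q' Q (fun m hm ↦ ?_) hl hlN
  exact subsingleton_extD_of_equiv R e.symm
    (subsingleton_extD_of_lt_grade (lt_of_lt_of_le (by exact_mod_cast hm) h))

theorem FGResolution.subsingleton_extD_one {R : Type u} [Ring R] {M : ModuleCat.{u} Rᵐᵒᵖ}
    (P : FGResolution M) (i : ℕ) (Q : FGPresentation (P.syzygy (i + 1))) :
    Subsingleton (ExtD R R (Q.transpose R R) 1) := by
  obtain ⟨f, g, w, hS⟩ := P.exists_shortExact i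
  have := P.projective_X i
  have := P.finite i
  exact subsingleton_extD_one_transpose f.hom ((ModuleCat.mono_iff_injective f).1 hS.mono_f) Q

theorem isTorsionfree_iff {R : Type u} [Ring R] {X : ModuleCat.{u} Rᵐᵒᵖ}
    (hX : Module.Finite Rᵐᵒᵖ X) (Q : FGPresentation X) (m : ℕ) :
    IsTorsionfree R m X ↔
      ∀ l, 1 ≤ l → l ≤ m → Subsingleton (ExtD R R (Q.transpose R R) l) := by
  refine ⟨fun h ↦ h.2 Q, fun h ↦ ⟨hX, fun Q' l hl hlm ↦ ?_⟩⟩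
  obtain ⟨e⟩ := nonempty_extD_transpose_equiv R R Q' Q hl
  have := h l hl hlm
  exact e.injective.subsingleton

theorem IsTorsionfree.mono {R : Type u} [Ring R] {X : ModuleCat.{u} Rᵐᵒᵖ} {m m' : ℕ}
    (h : IsTorsionfree R m' X) (hm : m ≤ m') : IsTorsionfree R m X :=
  ⟨h.1, fun Q l hl hlm ↦ h.2 Q l hl (hlm.trans hm)⟩

/-- If `Ω^i M` is `m`-torsionfree, then `Ω^{i+1} M` is `(m+1)`-torsionfree, provided that
`m ≤ grade Ext^{i+1}(M, R)`. -/
theorem FGResolution.isTorsionfree_succ {R : Type u} [Ring R] {M : ModuleCat.{u} Rᵐᵒᵖ}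
    (P : FGResolution M) (Q : ∀ i, FGPresentation (P.syzygy i)) {i m N : ℕ}
    (h : (N : ℕ∞) ≤ grade R R (ModuleCat.of R (ExtD Rᵐᵒᵖ R M (i + 1)))) (hm : m ≤ N)
    (ht : IsTorsionfree R m (P.syzygy i)) : IsTorsionfree R (m + 1) (P.syzygy (i + 1)) := by
  refine (isTorsionfree_iff (P.finite_syzygy _) (Q (i + 1)) _).2 fun l hl hlm ↦ ?_
  -- Degree 1 vanishes because a syzygy is torsionless; each higher degree injects into the
  -- preceding degree for `Ω^i M`.
  obtain ⟨l, rfl⟩ := Nat.exists_eq_add_of_le' hl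
  cases l with
  | zero => exact P.subsingleton_extD_one i (Q (i + 1))
  | succ l =>
    obtain ⟨f, hf, -⟩ := P.exists_extD_transpose_injective h (Q i) (Q (i + 1))
      (Nat.le_add_left 1 l) (by omega)
    have := ht.2 (Q i) (l + 1) (Nat.le_add_left 1 l) (by omega)
    exact hf.subsingleton

/-- The converse uses surjectivity of the comparison map in all degrees up to `m`, hence the strict
inequality `m < N`. -/
theorem FGResolution.isTorsionfree_of_succ {R : Type u} [Ring R] {M : ModuleCat.{u} Rᵐᵒᵖ}
    (P : FGResolution M) (Q : ∀ i, FGPresentation (P.syzygy i)) {i m N : ℕ}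
    (h : (N : ℕ∞) ≤ grade R R (ModuleCat.of R (ExtD Rᵐᵒᵖ R M (i + 1)))) (hm : m < N)
    (ht : IsTorsionfree R (m + 1) (P.syzygy (i + 1))) : IsTorsionfree R m (P.syzygy i) := by
  refine (isTorsionfree_iff (P.finite_syzygy _) (Q i) _).2 fun l hl hlm ↦ ?_
  obtain ⟨f, -, hf⟩ := P.exists_extD_transpose_injective h (Q i) (Q (i + 1)) hl (by omega)
  have := ht.2 (Q (i + 1)) (l + 1) (Nat.le_add_left 1 l) (by omega)
  exact (hf (by omega)).subsingleton

end

end StableModule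

theorem mainTheorem6 (R : Type u) [Ring R] [IsNoetherianRing R] [IsNoetherianRing Rᵐᵒᵖ]
    (n j : ℕ) (hn : 1 ≤ n) (hj : 1 ≤ j)
    (M : ModuleCat.{u} Rᵐᵒᵖ) (hM : Module.Finite Rᵐᵒᵖ M)
    (hgrade : ∀ i : ℕ, 1 ≤ i → i ≤ n →
      ((i + j - 1 : ℕ) : ℕ∞) ≤
        StableModule.grade R R (ModuleCat.of R (StableModule.ExtD Rᵐᵒᵖ R M i)))
    -- a projective resolution of `M`, defining `Ω^i M`, and a projective presentation of
    -- each `Ω^i M`, defining `Tr Ω^i M`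
    (P : StableModule.FGResolution M)
    (Q : ∀ i : ℕ, StableModule.FGPresentation (P.syzygy i)) :
    (∀ k : ℕ, 1 ≤ k → k ≤ j - 1 → ∀ i : ℕ, 1 ≤ i → i ≤ n →
      Nonempty (StableModule.ExtD R R ((Q i).transpose R R) (i + k) ≃ₗ[Rᵐᵒᵖ]
        StableModule.ExtD R R ((Q (i - 1)).transpose R R) (i - 1 + k))) ∧
    (∀ i : ℕ, 1 ≤ i → i ≤ n →
      ∃ f : StableModule.ExtD R R ((Q i).transpose R R) (i + j) →ₗ[Rᵐᵒᵖ]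
        StableModule.ExtD R R ((Q (i - 1)).transpose R R) (i - 1 + j),
        Function.Injective f) ∧
    -- the horizontal implications in the top row
    (∀ i : ℕ, 1 ≤ i → i ≤ n → StableModule.IsTorsionfree R (i - 1 + j) (P.syzygy (i - 1)) →
      StableModule.IsTorsionfree R (i + j) (P.syzygy i)) ∧
    -- the horizontal equivalences in the lower rows
    (∀ m : ℕ, m ≤ j - 1 → ∀ i : ℕ, 1 ≤ i → i ≤ n →
      (StableModule.IsTorsionfree R (i - 1 + m) (P.syzygy (i - 1)) ↔
        StableModule.IsTorsionfree R (i + m) (P.syzygy i))) ∧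
    -- the vertical implications
    (∀ m : ℕ, m ≤ j - 1 → ∀ i : ℕ, i ≤ n →
      StableModule.IsTorsionfree R (i + (m + 1)) (P.syzygy i) →
        StableModule.IsTorsionfree R (i + m) (P.syzygy i)) := by
  -- Reindexing by `i + 1` removes the truncated subtraction and gives the bound `N = i + j`.
  have hgr : ∀ i, i + 1 ≤ n → ((i + j : ℕ) : ℕ∞) ≤
      StableModule.grade R R (ModuleCat.of R (StableModule.ExtD Rᵐᵒᵖ R M (i + 1))) := by
    intro i hi
    have := hgrade (i + 1) (Nat.le_add_left 1 i) hi
    rwa [show i + 1 + j - 1 = i + j by omega] at this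
  refine ⟨fun k hk hkj i hi hin ↦ ?_, fun i hi hin ↦ ?_, fun i hi hin ht ↦ ?_,
    fun m hm i hi hin ↦ ?_, fun m _ i _ ht ↦ ht.mono (by omega)⟩
  all_goals
    obtain ⟨i, rfl⟩ := Nat.exists_eq_add_of_le' hi
    have h := hgr i hin
  -- Here `l = i + k < N`, so the map is bijective; in the next item `l = N` and only injectivity is
  -- available.
  · obtain ⟨f, hf, hf'⟩ := P.exists_extD_transpose_injective h (Q i) (Q (i + 1))
      (l := i + k) (by omega) (by omega)
    rw [show i + 1 + k = i + k + 1 by omega]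
    exact ⟨LinearEquiv.ofBijective f ⟨hf, hf' (by omega)⟩⟩
  · obtain ⟨f, hf, -⟩ := P.exists_extD_transpose_injective h (Q i) (Q (i + 1))
      (l := i + j) (by omega) le_rfl
    rw [show i + 1 + j = i + j + 1 by omega]
    exact ⟨f, hf⟩
  · rw [show i + 1 + j = i + j + 1 by omega]
    exact P.isTorsionfree_succ Q h le_rfl (by simpa only [Nat.add_sub_cancel] using ht)
  · rw [show i + 1 + m = i + m + 1 by omega]
    simp only [Nat.add_sub_cancel]
    exact ⟨P.isTorsionfree_succ Q h (by omega), P.isTorsionfree_of_succ Q h (by omega)⟩
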